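/- **Setting.** Let $d=p+q$ and let $\mathcal P_0$ be the set of Borel probability measures $P$ on $\mathbb R^p\times\mathbb R^q=\mathbb R^d$ with $P(A\times B)=P(\mathbb R^p\times B)\,P(A\times\mathbb R^q)$ for all Borel $A\subseteq\mathbb R^p$, $B\subseteq\mathbb R^q$. For a sample $z=(z_1,\dots,z_n)\in(\mathbb R^d)^n$ and a product cell $A=A^1\times A^2$ put $$\hat P_n(A)=\frac1n\sum_{i=1}^n\mathbf 1_A(z_i),\qquad \hat Q^*_n(A)=\hat P_n(A^1\times\mathbb R^q)\,\hat P_n(\mathbb R^p\times A^2).$$ **The trees.** Let $b_n\in(0,1)$. Grow a binary tree of cells from the root cell $\mathbb R^d$: at each node $v$ a coordinate is selected (by an arbitrary rule, which may depend on the data), and the cell $A_v$ is cut at the (lower) median $t$ of this coordinate over the sample points in $A_v$, into the part where the coordinate is $\le t$ and the part where it is $>t$; a node is split as long as both resulting cells have empirical probability at least $b_n$. The resulting tree is the full tree $T^{full}_{b_n}$. Write $T\ll T^{full}_{b_n}$ if $T$ is a binary subtree (each node has no or two children) of the full tree with the same root, $\pi_T$ for the partition of $\mathbb R^d$ into the cells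 of the leaves of $T$, and $|T|$ for the number of leaves. Put $$D_{\sigma(\pi)}(\hat P_n\|\hat Q^*_n)=\sum_{A\in\pi}\hat P_n(A)\log\frac{\hat P_n(A)}{\hat Q^*_n(A)},$$ and, for $\delta>0$, $r_{b_n,\delta}(1)=0$ and $$r_{b_n,\delta}(k)=\frac{24\sqrt2}{b_n\sqrt n}\sqrt{\ln\frac{8}{\delta\, b_n}+k\big[(d+1)\ln 2+d\ln n\big]}\qquad(k\ge2).$$ Let $\hat T_{b_n,\delta_n}$ be any maximizer of $D_{\sigma(\pi_T)}(\hat P_n\|\hat Q^*_n)-r_{b_n,\delta_n}(|T|)$ over $T\ll T^{full}_{b_n}$, and let $\pi_{b_n,\delta_n}=\{A_1,\dots,A_m\}$ be its partition. **The test.** For $a_n>0$, with $o_i$ the index of the cell of $\pi_{b_n,\delta_n}$ that contains $z_i$, put $$\hat i_n(z)=\frac1n\log\prod_{i=1}^n\frac{\hat P_n(A_{o_i})}{\hat Q^*_n(A_{o_i})},\qquad \phi_{b_n,\delta_n,a_n}(z)=\begin{cases}0,&\hat i_n(z)<a_n,\\1,&\hat i_n(z)\ge a_n.\end{cases}$$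 For $P\in\mathcal P_0$, the type-I error is $\alpha(b_n,\delta_n,a_n)=P^n(\{z:\phi_{b_n,\delta_n,a_n}(z)=1\})$, where $P^n$ is the law of $n$ i.i.d. samples of $P$. **Proposition.** Let $(b_n)_{n\ge1}$ in $(0,1)$ and $(\delta_n)_{n\ge1}$ in $(0,\infty)$ be such that $b_n\approx n^{-l}$ for some $l\in(0,1/3)$ (same order of magnitude), $\delta_n=o(1)$ and $1/\delta_n=O(e^{n^{1/3}})$. Then for every $P\in\mathcal P_0$ and all thresholds $a_n>0$, $$\alpha(b_n,\delta_n,a_n)\le\delta_n\qquad\text{for all } n\ge1 .$$ In particular the bound is uniform over $P\in\mathcal P_0$. -/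

import Mathlib

open MeasureTheory Filter Asymptotics

noncomputable section

namespace TSP

/-- The joint space `ℝ^p × ℝ^q = ℝ^d`, with `d = p + q`. -/
abbrev Pt (p q : ℕ) : Type := (Fin p → ℝ) × (Fin q → ℝ)

/-- The `d = p + q` coordinates of the joint space. -/
abbrev Coord (p q : ℕ) : Type := Fin p ⊕ Fin q

/-- The value of a coordinate at a point. -/
def coord {p q : ℕ} (j : Coord p q) (z : Pt p q) : ℝ :=
  Sum.elim z.1 z.2 j

/-- The class of probability measures on `ℝ^p × ℝ^q` under which `X` and `Y` are independent. -/
def indepModels (p q : ℕ) : Set (Measure (Pt p q)) :=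
  {P | IsProbabilityMeasure P ∧
    ∀ (A : Set (Fin p → ℝ)) (B : Set (Fin q → ℝ)), MeasurableSet A → MeasurableSet B →
      P (A ×ˢ B) = P (Set.univ ×ˢ B) * P (A ×ˢ Set.univ)}

/-- A cell with product structure `A = A¹ × A²`, given by its two factors. -/
abbrev Cell (p q : ℕ) : Type := Set (Fin p → ℝ) × Set (Fin q → ℝ)

/-- The subset of the joint space that a cell stands for. -/
def Cell.toSet {p q : ℕ} (A : Cell p q) : Set (Pt p q) := A.1 ×ˢ A.2

/-- The trivial cell `ℝ^d`. -/
def rootCell (p q : ℕ) : Cell p q := (Set.univ, Set.univ)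

/-- The empirical probability `P̂ₙ(A) = (1/n) ∑ 1_A(zᵢ)`. -/
def empProb {p q n : ℕ} (z : Fin n → Pt p q) (A : Cell p q) : ℝ :=
  1 / (n : ℝ) * ∑ i, A.toSet.indicator (fun _ => (1 : ℝ)) (z i)

/-- The empirical product probability `Q̂*ₙ(A¹ × A²) = P̂ₙ(A¹ × ℝ^q) P̂ₙ(ℝ^p × A²)`. -/
def empProd {p q n : ℕ} (z : Fin n → Pt p q) (A : Cell p q) : ℝ :=
  empProb z (A.1, Set.univ) * empProb z (Set.univ, A.2)

open Classical in
/-- The median of the ordered `j`-th coordinates of the sample points in the cell `A` (the lower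
median if their number is even). -/
def cellMedian {p q n : ℕ} (z : Fin n → Pt p q) (A : Cell p q) (j : Coord p q) : ℝ :=
  let ordered : List ℝ :=
    ((Finset.univ.filter fun i => z i ∈ A.toSet).val.map fun i => coord j (z i)).sort (· ≤ ·)
  ordered.getD ((ordered.length - 1) / 2) 0

/-- The two halves of the cell `A` cut by the hyperplane `{coordinate j = t}`: the left half
`{coordinate j ≤ t}` for `s = false`, the right half `{coordinate j > t}` for `s = true`. -/
def halfCell {p q : ℕ} (A : Cell p q) (j : Coord p q) (t : ℝ) (s : Bool) : Cell p q :=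
  match j, s with
  | Sum.inl i, false => ({x | x ∈ A.1 ∧ x i ≤ t}, A.2)
  | Sum.inl i, true => ({x | x ∈ A.1 ∧ t < x i}, A.2)
  | Sum.inr i, false => (A.1, {y | y ∈ A.2 ∧ y i ≤ t})
  | Sum.inr i, true => (A.1, {y | y ∈ A.2 ∧ t < y i})

/-- A node of the infinite binary tree. `[]` is the root; `false :: v` and `true :: v` are the left
and the right child of the node `v`. -/
abbrev Node : Type := List Bool

/-- A rule that selects, from the data, the coordinate along which each node is split. -/
abbrev CoordRule (p q n : ℕ) : Type := (Fin n → Pt p q) → Node → Coord p q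

/-- The cell `A_v` of a node: each cell is split at the median of the selected coordinate. -/
def cell {p q n : ℕ} (c : CoordRule p q n) (z : Fin n → Pt p q) : Node → Cell p q
  | [] => rootCell p q
  | s :: v => halfCell (cell c z v) (c z v) (cellMedian z (cell c z v) (c z v)) s

/-- The nodes of the full tree `T^full_b`: starting from the root, a node is split as long as both
cells that this creates have empirical probability at least `b`. -/
inductive IsFullNode {p q n : ℕ} (c : CoordRule p q n) (b : ℝ) (z : Fin n → Pt p q) : Node → Prop
  | root : IsFullNode c b z []
  | child (v : Node) (s : Bool) (hv : IsFullNode c b z v)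
      (hb : ∀ s' : Bool, b ≤ empProb z (cell c z (s' :: v))) : IsFullNode c b z (s :: v)

/-- All nodes of the (full) binary tree `T`, when its root is placed at the node `v`, are nodes of
the full tree `T^full_b`. Leaves of `T` are the `nil`s, so `nil` is the tree with one node. -/
def IsSubtreeAt {p q n : ℕ} (c : CoordRule p q n) (b : ℝ) (z : Fin n → Pt p q) :
    BinaryTree Unit → Node → Prop
  | .nil, v => IsFullNode c b z v
  | .node _ l r, v => IsFullNode c b z v ∧
      IsSubtreeAt c b z l (false :: v) ∧ IsSubtreeAt c b z r (true :: v)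

/-- The pruned versions `T ≪ T^full_b` of the full tree: its binary subtrees with the same root. -/
def prunings {p q n : ℕ} (c : CoordRule p q n) (b : ℝ) (z : Fin n → Pt p q) :
    Set (BinaryTree Unit) :=
  {T | IsSubtreeAt c b z T []}

/-- The leaves of the binary tree `T`, when its root is placed at the node `v`. -/
def leavesAt : BinaryTree Unit → Node → List Node
  | .nil, v => [v]
  | .node _ l r, v => leavesAt l (false :: v) ++ leavesAt r (true :: v)

/-- The partition `π_T = {A_v : v leaf of T}`. -/
def treePartition {p q n : ℕ} (c : CoordRule p q n) (z : Fin n → Pt p q) (T : BinaryTree Unit) :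
    List (Cell p q) :=
  (leavesAt T []).map (cell c z)

/-- The divergence `D_{σ(π)}(μ‖ν) = ∑_{A ∈ π} μ(A) log (μ(A) / ν(A))` over the cells of `π`. -/
def divOn {p q : ℕ} (μ ν : Cell p q → ℝ) (π : List (Cell p q)) : ℝ :=
  (π.map fun A => μ A * Real.log (μ A / ν A)).sum

/-- The confidence radius `ε_c(n, b, d, δ, k)`. -/
def confRadius (n : ℕ) (b : ℝ) (d : ℕ) (δ : ℝ) (k : ℕ) : ℝ :=
  24 * √2 / (b * √n) *
    √(Real.log (8 / δ) + k * ((d + 1) * Real.log 2 + d * Real.log n))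

/-- The penalty `r_{b,δ}(k) = ε_c(n, b, d, δ b, k)` of the trees with `k ≥ 2` leaves; the trivial
tree is not penalized, `r_{b,δ}(1) = 0`. -/
def penalty (n : ℕ) (b : ℝ) (d : ℕ) (δ : ℝ) (k : ℕ) : ℝ :=
  if k = 1 then 0 else confRadius n b d (δ * b) k

/-- The regularized empirical information `D_{σ(π_T)}(P̂ₙ‖Q̂*ₙ) - r_{b,δ}(|T|)`, where `|T|` is the
number of leaves of `T`. -/
def regInfo {p q n : ℕ} (c : CoordRule p q n) (b δ : ℝ) (z : Fin n → Pt p q)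
    (T : BinaryTree Unit) : ℝ :=
  divOn (empProb z) (empProd z) (treePartition c z T) - penalty n b (p + q) δ T.numLeaves

/-- `T` maximizes the regularized empirical information over the pruned versions of `T^full_b`. -/
def IsArgmax {p q n : ℕ} (c : CoordRule p q n) (b δ : ℝ) (z : Fin n → Pt p q)
    (T : BinaryTree Unit) : Prop :=
  T ∈ prunings c b z ∧ ∀ T' ∈ prunings c b z, regInfo c b δ z T' ≤ regInfo c b δ z T

/-- The quantization of a point by a partition `π = {A_0, …, A_{m-1}}`: the sum of `j 1_{A_j}`, that
is, the index of the cell that contains the point. -/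
def quantize {p q : ℕ} (π : List (Cell p q)) (z : Pt p q) : ℕ :=
  ∑ j : Fin π.length, (j : ℕ) * (π.get j).toSet.indicator (fun _ => 1) z

/-- The empirical log-likelihood ratio per sample of the quantized data,
`(1/n) log (∏ P̂(oᵢ) / ∏ Q̂(oᵢ))`, where `P̂(j) = P̂ₙ(A_j)` and `Q̂(j) = Q̂*ₙ(A_j)`. -/
def logLikelihood {p q n : ℕ} (π : List (Cell p q)) (z : Fin n → Pt p q) : ℝ :=
  1 / (n : ℝ) * Real.log
    ((∏ i, empProb z (π.getD (quantize π (z i)) (rootCell p q))) /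
      ∏ i, empProd z (π.getD (quantize π (z i)) (rootCell p q)))

open Classical in
/-- The test: decide `0` (independence) if the statistic is below the threshold `a`, otherwise `1`.
The tree is selected from the data by `That`. -/
def test {p q n : ℕ} (c : CoordRule p q n) (That : (Fin n → Pt p q) → BinaryTree Unit) (a : ℝ)
    (z : Fin n → Pt p q) : Fin 2 :=
  if logLikelihood (treePartition c z (That z)) z < a then 0 else 1

/-- The probability `P^n({z : φ(z) = 1})` that a decision rule of length `n` rejects independence
when the data are `n` independent samples of `P`. -/
def rejectionProb {p q n : ℕ} (P : Measure (Pt p q)) (φ : (Fin n → Pt p q) → Fin 2) : ℝ :=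
  (Measure.pi fun _ : Fin n => P).real {z | φ z = 1}

end TSP

end

/-! A positive threshold rules out rejection by the trivial tree, whose statistic is 0. A rejecting
maximizer is thus nontrivial, and comparison with the trivial tree gives empirical information at
least the penalty. Since leaf cells have mass at least `b`, `b` times this information is at most `∑
|P̂(A) - Q̂*(A)|`, which up to `n²` is `empGap` of a function with values `±1`, constant on leaf
cells (`exists_decisionTree_divOn_le`).

All cuts are at coordinates of sample points, so whatever the data-dependent choices, this function
comes from a finite family of decision trees, with at most `(dn+2)^(2k+1)` members having `k`
splits. Each depends on at most `k` sample points; freezing these costs `8nk` in the gap and leaves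
a fixed function (`measure_empGap_ge_le_of_dependsOn`). For fixed `f`, cyclic shifts write the gap
as `n` sums that are sub-Gaussian under independence (`hasSubgaussianMGF_empGap`). A union bound
over trees and `k` then gives total probability at most `δ`; as the rejection event is only included
in this union, no measurability of the selection is needed. -/

noncomputable section

namespace TSP

open ProbabilityTheory

/-! ### Concentration of the gap between joint and product empirical means -/

section Concentration

variable {X Y : Type*}

/-- The quantity `n ∑ i, f (xᵢ, yᵢ) - ∑ i, ∑ j, f (xᵢ, yⱼ)`, which compares the mean of `f` under the
empirical measure with its mean under the product of the empirical marginals. -/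
def empGap {n : ℕ} (f : X × Y → ℝ) (z : Fin n → X × Y) : ℝ :=
  ∑ i, ∑ j, (f (z i) - f ((z i).1, (z j).2))

/-- Pairs `(i, j)` are grouped by the cyclic difference `s = j - i`, so that each group involves
every `xᵢ` and every `yⱼ` exactly once. -/
lemma empGap_eq_sum_shift {n : ℕ} [NeZero n] (f : X × Y → ℝ) (z : Fin n → X × Y) :
    empGap f z = ∑ s, ∑ i, (f (z i) - f ((z i).1, (z (Equiv.addRight s i)).2)) := by
  rw [empGap]
  conv_rhs => rw [Finset.sum_comm]
  refine Finset.sum_congr rfl fun i _ => ?_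
  exact (Equiv.sum_comp (Equiv.addLeft i) fun j => f (z i) - f ((z i).1, (z j).2)).symm

lemma abs_empGap_sub_le {n : ℕ} (f : X × Y → ℝ) (hf : ∀ x, |f x| ≤ 1) (I : Finset (Fin n))
    (z z' : Fin n → X × Y) (h : ∀ i ∉ I, z i = z' i) :
    |empGap f z - empGap f z'| ≤ 8 * n * I.card := by
  -- A summand involves four values in `[-1, 1]`, and it changes only if `i` or `j` lies in `I`.
  have key : ∀ i j, |(f (z i) - f ((z i).1, (z j).2)) - (f (z' i) - f ((z' i).1, (z' j).2))| ≤
      4 * (if i ∈ I then 1 else 0) + 4 * (if j ∈ I then (1 : ℝ) else 0) := by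
    intro i j
    have h1 := abs_le.1 (hf (z i))
    have h2 := abs_le.1 (hf (z' i))
    have h3 := abs_le.1 (hf ((z i).1, (z j).2))
    have h4 := abs_le.1 (hf ((z' i).1, (z' j).2))
    by_cases hi : i ∈ I
    · rw [if_pos hi, abs_le]
      split_ifs <;> constructor <;> linarith
    · by_cases hj : j ∈ I
      · rw [if_pos hj, if_neg hi, abs_le]
        constructor <;> linarith
      · simp [hi, hj, h i hi, h j hj]
  rw [empGap, empGap, ← Finset.sum_sub_distrib]
  simp_rw [← Finset.sum_sub_distrib]
  calc _ ≤ ∑ i : Fin n, ∑ j : Fin n,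
        (4 * (if i ∈ I then 1 else 0) + 4 * (if j ∈ I then (1 : ℝ) else 0)) :=
        (Finset.abs_sum_le_sum_abs _ _).trans <| Finset.sum_le_sum fun i _ =>
          (Finset.abs_sum_le_sum_abs _ _).trans <| Finset.sum_le_sum fun j _ => key i j
    _ = 8 * n * I.card := by
        simp only [Finset.sum_add_distrib, ← Finset.mul_sum, Finset.sum_const, Finset.card_univ,
          Fintype.card_fin, nsmul_eq_mul, Finset.sum_boole, Finset.filter_mem_eq_inter,
          Finset.univ_inter]
        ring

variable [MeasurableSpace X] [MeasurableSpace Y]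

/-- This is where independence enters: the `y`-sample is exchangeable and independent of the
`x`-sample. -/
lemma measurePreserving_permute_snd {ι : Type*} [Fintype ι] (μ : Measure X) (ν : Measure Y)
    [IsProbabilityMeasure μ] [IsProbabilityMeasure ν] (e : Equiv.Perm ι) :
    MeasurePreserving (fun (z : ι → X × Y) i => ((z i).1, (z (e i)).2))
      (Measure.pi fun _ => μ.prod ν) (Measure.pi fun _ => μ.prod ν) := by
  have h1 := measurePreserving_arrowProdEquivProdArrow X Y ι (fun _ => μ) (fun _ => ν)
  have h2 := (measurePreserving_piCongrLeft (α := fun _ : ι => Y) (fun _ => ν) e.symm)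
  have h3 := (MeasurePreserving.id (Measure.pi fun _ : ι => μ)).prod h2
  have h4 := (h1.symm.comp h3).comp h1
  convert h4 using 1
  funext z i
  refine Prod.ext rfl ?_
  have := Equiv.piCongrLeft_apply_apply (fun _ : ι => Y) e.symm (fun i => (z i).2) (e i)
  rw [Equiv.symm_apply_apply] at this
  exact this.symm

lemma measurePreserving_piecewise {ι Ω : Type*} [Fintype ι] [MeasurableSpace Ω] (P : Measure Ω)
    [IsProbabilityMeasure P] (I : Finset ι) [∀ i, Decidable (i ∈ I)] :
    MeasurePreserving (fun (wz : (ι → Ω) × (ι → Ω)) => I.piecewise wz.1 wz.2)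
      ((Measure.pi fun _ => P).prod (Measure.pi fun _ => P)) (Measure.pi fun _ => P) := by
  have hm : Measurable fun (wz : (ι → Ω) × (ι → Ω)) => I.piecewise wz.1 wz.2 := by
    refine measurable_pi_lambda _ fun i => ?_
    by_cases hi : i ∈ I
    · simp only [Finset.piecewise, hi, if_true]; fun_prop
    · simp only [Finset.piecewise, hi, if_false]; fun_prop
  refine ⟨hm, (Measure.pi_eq fun s hs => ?_).symm⟩
  rw [Measure.map_apply hm (MeasurableSet.univ_pi hs)]
  have : (fun (wz : (ι → Ω) × (ι → Ω)) => I.piecewise wz.1 wz.2) ⁻¹' Set.univ.pi s =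
      (Set.univ.pi fun i => if i ∈ I then s i else Set.univ) ×ˢ
        (Set.univ.pi fun i => if i ∈ I then Set.univ else s i) := by
    ext ⟨w, z⟩
    simp only [Set.mem_preimage, Set.mem_pi, Set.mem_univ, true_implies, Set.mem_prod,
      Finset.piecewise]
    rw [← forall_and]
    refine forall_congr' fun i => ?_
    split_ifs <;> simp
  rw [this, Measure.prod_prod, Measure.pi_pi, Measure.pi_pi, ← Finset.prod_mul_distrib]
  refine Finset.prod_congr rfl fun i _ => ?_
  split_ifs <;> simp

/-- No independence is assumed: square roots of the parameters add. The shifted sums to which this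
applies share the same sample. -/
lemma hasSubgaussianMGF_finset_sum {Ω ι : Type*} [MeasurableSpace Ω] {μ : Measure Ω}
    [IsProbabilityMeasure μ] {Z : ι → Ω → ℝ} {c : NNReal}
    (h : ∀ i, HasSubgaussianMGF (Z i) c μ) (s : Finset ι) :
    HasSubgaussianMGF (fun ω => ∑ i ∈ s, Z i ω) ((s.card : NNReal) ^ 2 * c) μ := by
  classical
  induction s using Finset.induction_on with
  | empty => simp
  | insert i s hi ih =>
    simp_rw [Finset.sum_insert hi, Finset.card_insert_of_notMem hi]
    convert (h i).add ih using 1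
    rw [NNReal.sqrt_mul, NNReal.sqrt_sq, Nat.cast_succ]
    conv_lhs => rw [← NNReal.sq_sqrt c]
    ring

lemma hasSubgaussianMGF_sum_sub_integral {Ω : Type*} [MeasurableSpace Ω] (P : Measure Ω)
    [IsProbabilityMeasure P] (n : ℕ) {f : Ω → ℝ} (hf : Measurable f) (hf1 : ∀ x, |f x| ≤ 1) :
    HasSubgaussianMGF (fun z : Fin n → Ω => ∑ i, (f (z i) - ∫ x, f x ∂P)) n
      (Measure.pi fun _ => P) := by
  have h0 : HasSubgaussianMGF (fun x => f x - ∫ x, f x ∂P) 1 P := by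
    have := hasSubgaussianMGF_of_mem_Icc (μ := P) (X := f) (a := -1) (b := 1) hf.aemeasurable
      (ae_of_all _ fun x => abs_le.1 (hf1 x))
    convert this using 1
    ext
    norm_num
  have hind := iIndepFun_pi (μ := fun _ : Fin n => P)
    (X := fun _ x => f x - ∫ x, f x ∂P) (fun _ => (hf.sub_const _).aemeasurable)
  have := HasSubgaussianMGF.sum_of_iIndepFun hind (c := fun _ => 1) (s := Finset.univ)
    (fun i _ => by
      have hi := (measurePreserving_eval (fun _ : Fin n => P) i)
      refine HasSubgaussianMGF.of_map (Y := Function.eval i) (X := fun x => f x - ∫ x, f x ∂P)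
        hi.measurable.aemeasurable ?_
      rwa [hi.map_eq])
  simpa using this

lemma hasSubgaussianMGF_empGap {n : ℕ} [NeZero n] (μ : Measure X) (ν : Measure Y)
    [IsProbabilityMeasure μ] [IsProbabilityMeasure ν] {f : X × Y → ℝ} (hf : Measurable f)
    (hf1 : ∀ x, |f x| ≤ 1) :
    HasSubgaussianMGF (fun z : Fin n → X × Y => empGap f z) (4 * (n : NNReal) ^ 3)
      (Measure.pi fun _ => μ.prod ν) := by
  have hs := hasSubgaussianMGF_sum_sub_integral (μ.prod ν) n hf hf1
  have hshift : ∀ s : Fin n, HasSubgaussianMGF (fun z : Fin n → X × Y =>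
      ∑ i, (f (z i) - f ((z i).1, (z (Equiv.addRight s i)).2))) (4 * n)
      (Measure.pi fun _ => μ.prod ν) := by
    intro s
    have hp := measurePreserving_permute_snd μ ν (Equiv.addRight s)
    -- The re-paired sum has the same law as the original one, so the means cancel in the difference
    -- and the parameter is `(√n + √n)² = 4n`.
    have h2 := HasSubgaussianMGF.of_map hp.measurable.aemeasurable (by rw [hp.map_eq]; exact hs)
    convert hs.add h2.neg using 1
    · funext z
      simp [Finset.sum_sub_distrib]
    · have := NNReal.sq_sqrt (n : NNReal)
      rw [← two_mul, mul_pow, this]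
      norm_num
  convert hasSubgaussianMGF_finset_sum hshift Finset.univ using 1
  · funext z
    exact empGap_eq_sum_shift f z
  · simp only [Finset.card_univ, Fintype.card_fin]
    ring

lemma measure_empGap_ge_le {n : ℕ} [NeZero n] (μ : Measure X) (ν : Measure Y)
    [IsProbabilityMeasure μ] [IsProbabilityMeasure ν] {f : X × Y → ℝ} (hf : Measurable f)
    (hf1 : ∀ x, |f x| ≤ 1) {t : ℝ} (ht : 0 ≤ t) :
    (Measure.pi fun _ : Fin n => μ.prod ν) {z | t ≤ empGap f z} ≤
      ENNReal.ofReal (Real.exp (-t ^ 2 / (8 * n ^ 3))) := by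
  have := (hasSubgaussianMGF_empGap (n := n) μ ν hf hf1).measure_ge_le ht
  rw [← ENNReal.ofReal_toReal (measure_ne_top _ _)]
  refine ENNReal.ofReal_le_ofReal (this.trans_eq ?_)
  congr 2
  push_cast
  ring

/-- The tail bound for `empGap` when the function itself depends on the sample, through the points
with index in `I` only. -/
lemma measure_empGap_ge_le_of_dependsOn {n : ℕ} [NeZero n] (μ : Measure X) (ν : Measure Y)
    [IsProbabilityMeasure μ] [IsProbabilityMeasure ν] {f : (Fin n → X × Y) → X × Y → ℝ}
    (hf : Measurable (Function.uncurry f)) (hf1 : ∀ z x, |f z x| ≤ 1) (I : Finset (Fin n))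
    (hI : ∀ z z', (∀ i ∈ I, z i = z' i) → f z = f z') {t : ℝ} (ht : 0 ≤ t) :
    (Measure.pi fun _ : Fin n => μ.prod ν) {z | t + 8 * n * I.card ≤ empGap (f z) z} ≤
      ENNReal.ofReal (Real.exp (-t ^ 2 / (8 * n ^ 3))) := by
  set Q := Measure.pi fun _ : Fin n => μ.prod ν
  have hmeas : MeasurableSet {z | t + 8 * n * I.card ≤ empGap (f z) z} := by
    refine measurableSet_le measurable_const ?_
    unfold empGap
    refine Finset.measurable_sum _ fun i _ => Finset.measurable_sum _ fun j _ => ?_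
    exact (hf.comp (measurable_id.prodMk (measurable_pi_apply i))).sub
      (hf.comp (measurable_id.prodMk (by fun_prop)))
  have hp := measurePreserving_piecewise (μ.prod ν) I
  -- The points with index in `I` are taken from an independent copy `w`. Given `w`, the function `f
  -- w` is fixed and `z` is a fresh sample.
  rw [← hp.measure_preimage hmeas.nullMeasurableSet, Measure.prod_apply (hp.measurable hmeas)]
  calc _ ≤ ∫⁻ _w, ENNReal.ofReal (Real.exp (-t ^ 2 / (8 * n ^ 3))) ∂Q := by
        refine lintegral_mono fun w => ?_
        refine le_trans (measure_mono ?_) (measure_empGap_ge_le μ ν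
          (hf.comp (measurable_const.prodMk measurable_id)) (hf1 w) ht)
        intro z hz
        have hz' : t + 8 * n * I.card ≤
          empGap (f (I.piecewise w z)) (I.piecewise w z) := hz
        rw [hI (I.piecewise w z) w fun i hi => by simp [hi]] at hz'
        have := abs_le.1 (abs_empGap_sub_le (f w) (hf1 w) I (I.piecewise w z) z
          fun i hi => by simp [hi])
        change t ≤ empGap (f w) z
        linarith [this.2]
    _ = _ := by simp

end Concentration

/-! ### Decision trees: counting and dependence on the sample -/

/-- A binary tree whose inner nodes are labelled by tests and whose leaves are labelled by a sign. -/
inductive DecisionTree (α : Type*)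
  | leaf (s : Bool) : DecisionTree α
  | split (a : α) (l r : DecisionTree α) : DecisionTree α

namespace DecisionTree

variable {α : Type*}

/-- The number of inner nodes. -/
def numSplits : DecisionTree α → ℕ
  | leaf _ => 0
  | split _ l r => numSplits l + numSplits r + 1

/-- The preorder word of a tree. -/
def word : DecisionTree α → List (Bool ⊕ α)
  | leaf s => [Sum.inl s]
  | split a l r => Sum.inr a :: (word l ++ word r)

lemma length_word (t : DecisionTree α) : t.word.length = 2 * t.numSplits + 1 := by
  induction t with
  | leaf s => simp [word, numSplits]
  | split a l r hl hr => simp only [word, numSplits, List.length_cons, List.length_append]; omega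

/-- Preorder words form a prefix code; the tails `u`, `u'` let the induction peel off the left
subtree before the right one. -/
lemma word_append_inj (t t' : DecisionTree α) (u u' : List (Bool ⊕ α))
    (h : t.word ++ u = t'.word ++ u') : t = t' ∧ u = u' := by
  induction t generalizing t' u u' with
  | leaf s => cases t' <;> simp_all [word]
  | split a l r hl hr =>
    cases t' with
    | leaf s => simp [word] at h
    | split a' l' r' =>
      simp only [word, List.cons_append, List.cons.injEq, Sum.inr.injEq, List.append_assoc] at h
      obtain ⟨rfl, h⟩ := h
      obtain ⟨hll, h⟩ := hl _ _ _ h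
      obtain ⟨hrr, h⟩ := hr _ _ _ h
      exact ⟨by rw [hll, hrr], h⟩

lemma word_injective : Function.Injective (word : DecisionTree α → List (Bool ⊕ α)) :=
  fun t t' h => (word_append_inj t t' [] [] (by rw [h])).1

/-- The preorder word of a tree with `m` inner nodes, as a vector. -/
def wordVector (m : ℕ) (t : {t : DecisionTree α // t.numSplits = m}) :
    List.Vector (Bool ⊕ α) (2 * m + 1) :=
  ⟨t.1.word, by rw [length_word, t.2]⟩

lemma wordVector_injective (m : ℕ) : Function.Injective (wordVector (α := α) m) :=
  fun _ _ h => Subtype.ext (word_injective (congrArg Subtype.val h))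

instance finite_numSplits_eq [Finite α] (m : ℕ) :
    Finite {t : DecisionTree α // t.numSplits = m} := by
  have := Fintype.ofFinite α
  exact Finite.of_injective _ (wordVector_injective m)

lemma card_numSplits_eq_le [Fintype α] (m : ℕ) :
    Nat.card {t : DecisionTree α // t.numSplits = m} ≤ (Fintype.card α + 2) ^ (2 * m + 1) := by
  refine (Nat.card_le_card_of_injective _ (wordVector_injective m)).trans_eq ?_
  rw [Nat.card_eq_fintype_card, card_vector, Fintype.card_sum, Fintype.card_bool, add_comm]

variable {p q n : ℕ}

/-- The `±1`-valued function of a decision tree whose test `(j, i)` compares the `j`-th coordinate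
with that of the `i`-th sample point. -/
def signFun (z : Fin n → Pt p q) : DecisionTree (Coord p q × Fin n) → Pt p q → ℝ
  | leaf s, _ => if s then 1 else -1
  | split a l r, x =>
      if coord a.1 x ≤ coord a.1 (z a.2) then signFun z l x else signFun z r x

/-- The indices of the sample points used by the tests of a decision tree. -/
def sampleIndices : DecisionTree (Coord p q × Fin n) → Finset (Fin n)
  | leaf _ => ∅
  | split a l r => insert a.2 (sampleIndices l ∪ sampleIndices r)

lemma card_sampleIndices_le (t : DecisionTree (Coord p q × Fin n)) :
    t.sampleIndices.card ≤ t.numSplits := by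
  induction t with
  | leaf s => simp [sampleIndices]
  | split a l r hl hr =>
    have h1 := Finset.card_insert_le a.2 (sampleIndices l ∪ sampleIndices r)
    have h2 := Finset.card_union_le (sampleIndices l) (sampleIndices r)
    simp only [sampleIndices, numSplits]
    omega

lemma abs_signFun_le (t : DecisionTree (Coord p q × Fin n)) (z : Fin n → Pt p q) (x : Pt p q) :
    |t.signFun z x| ≤ 1 := by
  induction t with
  | leaf s => cases s <;> simp [signFun]
  | split a l r hl hr => rw [signFun]; split_ifs <;> assumption

lemma signFun_congr (t : DecisionTree (Coord p q × Fin n)) (z z' : Fin n → Pt p q)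
    (h : ∀ i ∈ t.sampleIndices, z i = z' i) : t.signFun z = t.signFun z' := by
  induction t with
  | leaf s => rfl
  | split a l r hl hr =>
    simp only [sampleIndices, Finset.mem_insert, Finset.mem_union] at h
    funext x
    rw [signFun, signFun, h a.2 (Or.inl rfl), hl fun i hi => h i (by tauto),
      hr fun i hi => h i (by tauto)]

end DecisionTree

variable {p q n : ℕ}

/-! ### Cells, medians and empirical probabilities -/

lemma measurable_coord (j : Coord p q) : Measurable (coord j : Pt p q → ℝ) := by
  rcases j with i | i
  · exact (measurable_pi_apply i).comp measurable_fst
  · exact (measurable_pi_apply i).comp measurable_snd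

lemma DecisionTree.measurable_signFun (t : DecisionTree (Coord p q × Fin n)) :
    Measurable (Function.uncurry fun (z : Fin n → Pt p q) x => t.signFun z x) := by
  induction t with
  | leaf s => exact measurable_const
  | split a l r hl hr =>
    exact Measurable.ite (measurableSet_le ((measurable_coord a.1).comp measurable_snd)
      ((measurable_coord a.1).comp ((measurable_pi_apply a.2).comp measurable_fst))) hl hr

lemma mem_halfCell_false (A : Cell p q) (j : Coord p q) (t : ℝ) (x : Pt p q) :
    x ∈ (halfCell A j t false).toSet ↔ x ∈ A.toSet ∧ coord j x ≤ t := by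
  rcases j with i | i <;> simp [halfCell, Cell.toSet, coord] <;> tauto

lemma mem_halfCell_true (A : Cell p q) (j : Coord p q) (t : ℝ) (x : Pt p q) :
    x ∈ (halfCell A j t true).toSet ↔ x ∈ A.toSet ∧ t < coord j x := by
  rcases j with i | i <;> simp [halfCell, Cell.toSet, coord] <;> tauto

lemma exists_coord_eq_cellMedian (z : Fin n → Pt p q) (A : Cell p q) (j : Coord p q)
    (h : ∃ i, z i ∈ A.toSet) : ∃ i, coord j (z i) = cellMedian z A j := by
  classical
  obtain ⟨i₀, hi₀⟩ := h
  simp only [cellMedian]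
  set M := (Finset.univ.filter fun i => z i ∈ A.toSet).val.map fun i => coord j (z i) with hM
  have hpos : 0 < (M.sort (· ≤ ·)).length := by
    rw [Multiset.length_sort, hM, Multiset.card_map]
    exact Finset.card_pos.2 ⟨i₀, by simpa using hi₀⟩
  -- The index is in range, so the default value 0 in the median is not used.
  have hlt : ((M.sort (· ≤ ·)).length - 1) / 2 < (M.sort (· ≤ ·)).length := by omega
  have hmem : (M.sort (· ≤ ·)).getD (((M.sort (· ≤ ·)).length - 1) / 2) 0 ∈ M := by
    rw [List.getD_eq_getElem _ _ hlt, ← Multiset.mem_sort (r := (· ≤ ·))]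
    exact List.getElem_mem _
  obtain ⟨i, -, hi⟩ := Multiset.mem_map.1 hmem
  refine ⟨i, ?_⟩
  convert hi

lemma empProb_eq (z : Fin n → Pt p q) (A : Cell p q) :
    empProb z A = (∑ i, A.toSet.indicator (fun _ => (1 : ℝ)) (z i)) / n := by
  rw [empProb]; ring

lemma empProb_nonneg (z : Fin n → Pt p q) (A : Cell p q) : 0 ≤ empProb z A :=
  mul_nonneg (by positivity) <| Finset.sum_nonneg fun i _ =>
    Set.indicator_nonneg (fun _ _ => zero_le_one) _

lemma exists_mem_of_empProb_pos (z : Fin n → Pt p q) (A : Cell p q) (h : 0 < empProb z A) :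
    ∃ i, z i ∈ A.toSet := by
  by_contra! hne
  simp [empProb, hne] at h

lemma one_div_le_empProb (z : Fin n → Pt p q) (A : Cell p q) (h : 0 < empProb z A) :
    1 / (n : ℝ) ≤ empProb z A := by
  obtain ⟨i, hi⟩ := exists_mem_of_empProb_pos z A h
  have := Finset.single_le_sum (f := fun i => A.toSet.indicator (fun _ => (1 : ℝ)) (z i))
    (fun i _ => Set.indicator_nonneg (fun _ _ => zero_le_one) _) (Finset.mem_univ i)
  simp only [Set.indicator_of_mem hi] at this
  rw [empProb]
  exact le_mul_of_one_le_right (by positivity) this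

lemma empProb_mono (z : Fin n → Pt p q) {A B : Cell p q} (h : A.toSet ⊆ B.toSet) :
    empProb z A ≤ empProb z B :=
  mul_le_mul_of_nonneg_left (Finset.sum_le_sum fun i _ =>
    Set.indicator_le_indicator_of_subset h (fun _ => zero_le_one) _) (by positivity)

lemma empProb_rootCell [NeZero n] (z : Fin n → Pt p q) : empProb z (rootCell p q) = 1 := by
  simp [empProb, rootCell, Cell.toSet, NeZero.ne n]

lemma sq_empProb_le_empProd (z : Fin n → Pt p q) (A : Cell p q) :
    empProb z A ^ 2 ≤ empProd z A := by
  rw [sq, empProd]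
  exact mul_le_mul (empProb_mono z (Set.prod_mono subset_rfl (Set.subset_univ _)))
    (empProb_mono z (Set.prod_mono (Set.subset_univ _) subset_rfl)) (empProb_nonneg z A)
    (empProb_nonneg z _)

lemma empProd_eq (z : Fin n → Pt p q) (A : Cell p q) :
    empProd z A =
      (∑ i, ∑ j, A.toSet.indicator (fun _ => (1 : ℝ)) ((z i).1, (z j).2)) / (n : ℝ) ^ 2 := by
  rw [empProd, empProb_eq, empProb_eq, div_mul_div_comm, ← sq, Finset.sum_mul_sum]
  congr 1
  refine Finset.sum_congr rfl fun i _ => Finset.sum_congr rfl fun j _ => ?_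
  by_cases h1 : (z i).1 ∈ A.1 <;> by_cases h2 : (z j).2 ∈ A.2 <;>
    simp [Cell.toSet, Set.indicator, h1, h2]

lemma empGap_indicator [NeZero n] (z : Fin n → Pt p q) (A : Cell p q) :
    empGap (A.toSet.indicator fun _ => (1 : ℝ)) z =
      (n : ℝ) ^ 2 * (empProb z A - empProd z A) := by
  have hn : (n : ℝ) ≠ 0 := Nat.cast_ne_zero.2 (NeZero.ne n)
  rw [empProb_eq, empProd_eq, empGap]
  simp only [Finset.sum_sub_distrib, Finset.sum_const, Finset.card_univ, Fintype.card_fin,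
    nsmul_eq_mul, ← Finset.mul_sum]
  field_simp

lemma empGap_listSum {X Y β : Type*} (z : Fin n → X × Y) (L : List β) (f : β → X × Y → ℝ) :
    empGap (fun x => (L.map fun u => f u x).sum) z = (L.map fun u => empGap (f u) z).sum := by
  induction L with
  | nil => simp [empGap]
  | cons u L ih =>
    rw [List.map_cons, List.sum_cons, ← ih]
    simp only [empGap, List.map_cons, List.sum_cons, ← Finset.sum_add_distrib]
    refine Finset.sum_congr rfl fun i _ => Finset.sum_congr rfl fun j _ => ?_
    ring

/-! ### Pruned trees and their empirical information -/

variable {c : CoordRule p q n} {b : ℝ} {z : Fin n → Pt p q}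

lemma IsFullNode.le_empProb [NeZero n] (hb : b ≤ 1) {v : Node} (h : IsFullNode c b z v) :
    b ≤ empProb z (cell c z v) := by
  cases h with
  | root => rw [cell, empProb_rootCell]; exact hb
  | child v s hv hs => exact hs s

lemma IsSubtreeAt.isFullNode {T : BinaryTree Unit} {v : Node} (h : IsSubtreeAt c b z T v) :
    IsFullNode c b z v := by
  cases T with
  | nil => exact h
  | node _ l r => exact h.1

lemma IsSubtreeAt.isFullNode_of_mem_leavesAt {T : BinaryTree Unit} {v : Node}
    (h : IsSubtreeAt c b z T v) {u : Node} (hu : u ∈ leavesAt T v) : IsFullNode c b z u := by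
  induction T generalizing v with
  | nil =>
    rw [leavesAt, List.mem_singleton] at hu
    exact hu ▸ h
  | node _ l r hl hr =>
    rw [leavesAt, List.mem_append] at hu
    exact hu.elim (hl h.2.1) (hr h.2.2)

lemma length_leavesAt (T : BinaryTree Unit) (v : Node) :
    (leavesAt T v).length = T.numLeaves := by
  induction T generalizing v with
  | nil => rfl
  | node _ l r hl hr => rw [leavesAt, List.length_append, hl, hr, BinaryTree.numLeaves]

/-- A signed sum of indicators of the leaf cells below `v` agrees on the cell of `v` with the
function of a decision tree whose cuts are sample points. -/
lemma IsSubtreeAt.exists_decisionTree [NeZero n] (hb0 : 0 < b) (hb1 : b ≤ 1)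
    {T : BinaryTree Unit} {v : Node} (h : IsSubtreeAt c b z T v) (σ : Node → Bool) :
    ∃ t : DecisionTree (Coord p q × Fin n), t.numSplits + 1 = T.numLeaves ∧ ∀ x,
      ((leavesAt T v).map fun u => (if σ u then (1 : ℝ) else -1) *
        (cell c z u).toSet.indicator (fun _ => (1 : ℝ)) x).sum =
      (cell c z v).toSet.indicator (fun _ => (1 : ℝ)) x * t.signFun z x := by
  induction T generalizing v with
  | nil =>
    refine ⟨.leaf (σ v), rfl, fun x => ?_⟩
    simp [leavesAt, DecisionTree.signFun, mul_comm]
  | node _ l r hl hr =>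
    obtain ⟨tl, htl, hxl⟩ := hl h.2.1
    obtain ⟨tr, htr, hxr⟩ := hr h.2.2
    obtain ⟨i, hi⟩ := exists_coord_eq_cellMedian z (cell c z v) (c z v)
      (exists_mem_of_empProb_pos z _ (hb0.trans_le (h.1.le_empProb hb1)))
    refine ⟨.split (c z v, i) tl tr, ?_, fun x => ?_⟩
    · rw [DecisionTree.numSplits, BinaryTree.numLeaves]; omega
    · rw [leavesAt, List.map_append, List.sum_append, hxl, hxr, DecisionTree.signFun, hi]
      classical
      simp only [Set.indicator_apply, cell, mem_halfCell_false, mem_halfCell_true]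
      by_cases hx : x ∈ (cell c z v).toSet <;>
        by_cases hc : coord (c z v) x ≤ cellMedian z (cell c z v) (c z v) <;>
        simp [hx, hc, not_lt.2, not_le.1]

lemma empProb_cell_children (v : Node) :
    empProb z (cell c z (false :: v)) + empProb z (cell c z (true :: v)) =
      empProb z (cell c z v) := by
  classical
  rw [empProb, empProb, empProb, ← mul_add, ← Finset.sum_add_distrib]
  congr 1
  refine Finset.sum_congr rfl fun i _ => ?_
  simp only [Set.indicator_apply, cell, mem_halfCell_false, mem_halfCell_true]
  by_cases hx : z i ∈ (cell c z v).toSet <;>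
    by_cases hc : coord (c z v) (z i) ≤ cellMedian z (cell c z v) (c z v) <;>
    simp [hx, hc, not_lt.2, not_le.1]

lemma sum_empProb_leavesAt (T : BinaryTree Unit) (v : Node) :
    ((leavesAt T v).map fun u => empProb z (cell c z u)).sum = empProb z (cell c z v) := by
  induction T generalizing v with
  | nil => simp [leavesAt]
  | node _ l r hl hr =>
    rw [leavesAt, List.map_append, List.sum_append, hl, hr, empProb_cell_children]

/-- Leaf masses add up to 1, and each, being positive, is at least `1/n`. -/
lemma numLeaves_le_of_mem_prunings [NeZero n] (hb0 : 0 < b) (hb1 : b ≤ 1) {T : BinaryTree Unit}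
    (hT : T ∈ prunings c b z) : T.numLeaves ≤ n := by
  have hn : (0 : ℝ) < n := Nat.cast_pos.2 (NeZero.pos n)
  have hsum := sum_empProb_leavesAt (c := c) (z := z) T []
  rw [cell, empProb_rootCell] at hsum
  have hle : ((leavesAt T []).map fun _ => 1 / (n : ℝ)).sum ≤
      ((leavesAt T []).map fun u => empProb z (cell c z u)).sum :=
    List.sum_le_sum fun u hu => one_div_le_empProb z _
      (hb0.trans_le ((IsSubtreeAt.isFullNode_of_mem_leavesAt hT hu).le_empProb hb1))
  rw [hsum, List.map_const', List.sum_replicate, length_leavesAt, nsmul_eq_mul, mul_one_div,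
    div_le_one hn] at hle
  exact_mod_cast hle

/-- Combines `log u ≤ u - 1` with `y ≥ x² ≥ bx`, which bounds the ratio `x / y` by `1 / b`. -/
lemma mul_log_div_le {x y : ℝ} (hb0 : 0 < b) (hx : b ≤ x) (hxy : x ^ 2 ≤ y) :
    b * (x * Real.log (x / y)) ≤ |x - y| := by
  have hx0 : 0 < x := hb0.trans_le hx
  have hy0 : 0 < y := lt_of_lt_of_le (by positivity) hxy
  have h1 : Real.log (x / y) ≤ (x - y) / y := by
    have := Real.log_le_sub_one_of_pos (div_pos hx0 hy0)
    rwa [sub_div, div_self hy0.ne']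
  have h2 : b * x / y ≤ 1 := by
    rw [div_le_one hy0]
    nlinarith
  calc b * (x * Real.log (x / y)) = b * x * Real.log (x / y) := by ring
    _ ≤ b * x * ((x - y) / y) := by gcongr
    _ = b * x / y * (x - y) := by ring
    _ ≤ b * x / y * |x - y| := by gcongr; exact le_abs_self _
    _ ≤ 1 * |x - y| := by gcongr
    _ = |x - y| := one_mul _

/-- The empirical information of a pruned tree is controlled by the empirical gap of the function
of a decision tree whose cuts are sample points. -/
lemma exists_decisionTree_divOn_le [NeZero n] (hb0 : 0 < b) (hb1 : b ≤ 1)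
    {T : BinaryTree Unit} (hT : T ∈ prunings c b z) :
    ∃ t : DecisionTree (Coord p q × Fin n), t.numSplits + 1 = T.numLeaves ∧
      (n : ℝ) ^ 2 * (b * divOn (empProb z) (empProd z) (treePartition c z T)) ≤
        empGap (t.signFun z) z := by
  classical
  -- The signs turn the sum of absolute differences into a linear functional of one function.
  set σ : Node → Bool := fun u => decide (empProd z (cell c z u) ≤ empProb z (cell c z u))
  have hσ : ∀ u, (if σ u then (1 : ℝ) else -1) *
      (empProb z (cell c z u) - empProd z (cell c z u)) =
      |empProb z (cell c z u) - empProd z (cell c z u)| := by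
    intro u
    by_cases h : empProd z (cell c z u) ≤ empProb z (cell c z u)
    · simp [σ, h, abs_of_nonneg (sub_nonneg.2 h)]
    · simp [σ, h, abs_of_neg (sub_neg.2 (not_le.1 h))]
  obtain ⟨t, ht, hx⟩ := IsSubtreeAt.exists_decisionTree hb0 hb1 hT σ
  refine ⟨t, ht, ?_⟩
  have hfun : t.signFun z = fun x => ((leavesAt T []).map fun u => (if σ u then (1 : ℝ) else -1) *
        (cell c z u).toSet.indicator (fun _ => (1 : ℝ)) x).sum := by
    funext x
    rw [hx x]
    simp [cell, rootCell, Cell.toSet]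
  have hmul : ∀ (r : ℝ) (f : Pt p q → ℝ), empGap (fun x => r * f x) z = r * empGap f z := by
    intro r f
    simp only [empGap, Finset.mul_sum, mul_sub]
  rw [hfun, empGap_listSum z _ fun u x => (if σ u then (1 : ℝ) else -1) *
        (cell c z u).toSet.indicator (fun _ => (1 : ℝ)) x]
  simp only [hmul, empGap_indicator, divOn, treePartition, List.map_map, ← List.sum_map_mul_left]
  refine List.sum_le_sum fun u hu => ?_
  have hle := (IsSubtreeAt.isFullNode_of_mem_leavesAt hT hu).le_empProb hb1
  rw [mul_left_comm _ ((n : ℝ) ^ 2), hσ]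
  exact mul_le_mul_of_nonneg_left (mul_log_div_le hb0 hle (sq_empProb_le_empProd z _))
    (by positivity)

lemma logLikelihood_nil [NeZero n] : logLikelihood (treePartition c z .nil) z = 0 := by
  have h : treePartition c z .nil = [rootCell p q] := rfl
  have hq : ∀ x, quantize [rootCell p q] x = 0 := fun x => by simp [quantize]
  have h2 : empProd z (rootCell p q) = 1 := by
    have := empProb_rootCell z
    simp only [rootCell] at this
    rw [empProd, rootCell, this, one_mul]
  simp [h, logLikelihood, hq, h2, empProb_rootCell]

lemma regInfo_nil [NeZero n] (δ : ℝ) : regInfo c b δ z .nil = 0 := by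
  have h2 : empProd z (rootCell p q) = 1 := by
    have := empProb_rootCell z
    simp only [rootCell] at this
    rw [empProd, rootCell, this, one_mul]
  simp [regInfo, treePartition, leavesAt, cell, divOn, penalty, BinaryTree.numLeaves,
    empProb_rootCell, h2]

/-! ### Penalty, union bound and level -/

/-- The exponent in the confidence radius of the trees with `k` leaves. -/
def complexity (n : ℕ) (d : ℕ) (δ : ℝ) (k : ℕ) : ℝ :=
  Real.log (8 / δ) + k * ((d + 1) * Real.log 2 + d * Real.log n)

lemma confRadius_eq (n : ℕ) (b : ℝ) (d : ℕ) (δ : ℝ) (k : ℕ) :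
    confRadius n b d δ k = 24 * √2 / (b * √n) * √(complexity n d δ k) := rfl

lemma le_complexity {n d : ℕ} (hd : 1 ≤ d) {δ : ℝ} (hδ0 : 0 < δ) (hδ1 : δ ≤ 1)
    (k : ℕ) : (k : ℝ) ≤ complexity n d δ k := by
  have h1 : 0 ≤ Real.log (8 / δ) := Real.log_nonneg ((one_le_div hδ0).2 (by linarith))
  have h2 : 0 ≤ Real.log n := Real.log_natCast_nonneg n
  have h3 : (1 : ℝ) ≤ (d + 1) * Real.log 2 + d * Real.log n := by
    have := Real.log_two_gt_d9
    have hd' : (1 : ℝ) ≤ d := by exact_mod_cast hd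
    nlinarith [mul_nonneg (by positivity : (0 : ℝ) ≤ d) h2]
  have : (k : ℝ) * 1 ≤ k * ((d + 1) * Real.log 2 + d * Real.log n) := by gcongr
  rw [complexity]
  linarith

/-- Rejection forces a large empirical gap of the function of some decision tree. -/
lemma exists_decisionTree_of_isArgmax [NeZero n] (hd : 1 ≤ p + q) (hb0 : 0 < b) (hb1 : b ≤ 1)
    {δ : ℝ} (hδ0 : 0 < δ) (hδ1 : δ ≤ 1) {T : BinaryTree Unit} (hT : IsArgmax c b δ z T) {a : ℝ}
    (ha : 0 < a) (hrej : a ≤ logLikelihood (treePartition c z T) z) :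
    ∃ k ∈ Finset.range n, ∃ t : {t : DecisionTree (Coord p q × Fin n) // t.numSplits = k},
      8 * √((n : ℝ) ^ 3 * complexity n (p + q) (δ * b) (k + 1)) + 8 * n * k ≤
        empGap (t.1.signFun z) z := by
  have hn1 : 1 ≤ n := NeZero.one_le
  have hn : (0 : ℝ) < n := Nat.cast_pos.2 hn1
  obtain ⟨t, ht, hgap⟩ := exists_decisionTree_divOn_le hb0 hb1 hT.1
  have hkn := numLeaves_le_of_mem_prunings hb0 hb1 hT.1
  have hne : T.numLeaves ≠ 1 := by
    intro h1
    cases T with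
    | nil => rw [logLikelihood_nil] at hrej; exact absurd hrej (not_le.2 ha)
    | node _ l r =>
      have := l.numLeaves_pos
      have := r.numLeaves_pos
      rw [BinaryTree.numLeaves] at h1
      omega
  refine ⟨t.numSplits, Finset.mem_range.2 (by omega), ⟨t, rfl⟩, ?_⟩
  have hreg := hT.2 .nil (show IsFullNode c b z [] from .root)
  rw [regInfo_nil, regInfo, penalty, if_neg hne, sub_nonneg, confRadius_eq, ← ht] at hreg
  have hL := le_complexity (n := n) hd (mul_pos hδ0 hb0) (mul_le_one₀ hδ1 hb0.le hb1) (t.numSplits + 1)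
  set L := complexity n (p + q) (δ * b) (t.numSplits + 1) with hLdef
  have hL0 : 0 ≤ L := le_trans (by positivity) hL
  have hk : (t.numSplits : ℝ) + 1 ≤ n := by exact_mod_cast ht ▸ hkn
  push_cast at hL
  refine le_trans ?_ hgap
  have h2 : (1 : ℝ) ≤ √2 := Real.one_le_sqrt.2 one_le_two
  have hs : 0 < √(n : ℝ) := Real.sqrt_pos.2 hn
  have hsq : √(n : ℝ) * √(n : ℝ) = n := Real.mul_self_sqrt hn.le
  have hroot : √((n : ℝ) ^ 3 * L) = n * √(n : ℝ) * √L := by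
    rw [Real.sqrt_mul (by positivity), show (n : ℝ) ^ 3 = (n : ℝ) ^ 2 * n by ring,
      Real.sqrt_mul (by positivity), Real.sqrt_sq hn.le]
  -- The number of splits is at most both `n` and `L`. Hence the freezing cost `8nk` is no larger
  -- than the deviation term, and `16 ≤ 24√2` absorbs both.
  have hkL : (t.numSplits : ℝ) ≤ √(n : ℝ) * √L := by
    rw [← Real.sqrt_mul hn.le]
    refine Real.le_sqrt_of_sq_le ?_
    rw [sq]
    exact mul_le_mul (by linarith) (by linarith) (by positivity) hn.le
  calc 8 * √((n : ℝ) ^ 3 * L) + 8 * n * t.numSplits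
      ≤ 8 * (n * √(n : ℝ) * √L) + 8 * n * (√(n : ℝ) * √L) := by rw [hroot]; gcongr
    _ = 16 * (n * √(n : ℝ) * √L) := by ring
    _ ≤ 24 * √2 * (n * √(n : ℝ) * √L) := by gcongr; linarith
    _ = (n : ℝ) ^ 2 * (b * (24 * √2 / (b * √n) * √L)) := by
        field_simp
        rw [sq, hsq]
    _ ≤ _ := by gcongr

lemma card_mul_exp_le {n d : ℕ} (hn : 1 ≤ n) (hd : 1 ≤ d) {δ b : ℝ} (hδ0 : 0 < δ) (hδ1 : δ ≤ 1)
    (hb0 : 0 < b) (hb1 : b ≤ 1) (k : ℕ) :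
    ((d * n + 2 : ℕ) : ℝ) ^ (2 * k + 1) *
      Real.exp (-(8 * √((n : ℝ) ^ 3 * complexity n d (δ * b) (k + 1))) ^ 2 / (8 * n ^ 3)) ≤
      δ * (1 / 2) ^ (k + 1) := by
  have hn' : (1 : ℝ) ≤ n := by exact_mod_cast hn
  have hd' : (1 : ℝ) ≤ d := by exact_mod_cast hd
  have hL0 : 0 ≤ complexity n d (δ * b) (k + 1) := le_trans (by positivity)
    (le_complexity hd (mul_pos hδ0 hb0) (mul_le_one₀ hδ1 hb0.le hb1) (k + 1))
  have hlogn : 0 ≤ Real.log n := Real.log_natCast_nonneg n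
  set e : ℝ := (d + 1) * Real.log 2 + d * Real.log n with he
  have hexp_e : Real.exp e = 2 ^ (d + 1) * (n : ℝ) ^ d := by
    rw [he, Real.exp_add]
    congr 1
    · rw [← Real.exp_log (show (0 : ℝ) < 2 ^ (d + 1) by positivity), Real.log_pow]
      push_cast; rfl
    · rw [← Real.exp_log (show (0 : ℝ) < (n : ℝ) ^ d by positivity), Real.log_pow]
  have hd2 : (d : ℝ) + 1 ≤ 2 ^ d := by exact_mod_cast Nat.lt_two_pow_self (n := d)
  have hnd : (n : ℝ) ≤ (n : ℝ) ^ d := le_self_pow₀ hn' (by omega)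
  -- Each letter of a preorder word costs at most a factor `exp e`, because `dn + 2 ≤ 2(d+1)n ≤
  -- 2^(d+1) n^d`.
  have hbase : ((d * n + 2 : ℕ) : ℝ) ≤ Real.exp e := by
    rw [hexp_e, pow_succ]
    push_cast
    have h1 : ((d : ℝ) + 1) * n ≤ 2 ^ d * (n : ℝ) ^ d := by gcongr
    nlinarith
  have he2 : (2 : ℝ) ≤ Real.exp e := le_trans (by push_cast; nlinarith) hbase
  have hlog : Real.exp (-Real.log (8 / (δ * b))) ≤ δ := by
    rw [Real.exp_neg, Real.exp_log (by positivity), inv_div, div_le_iff₀ (by norm_num)]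
    nlinarith
  -- The exponent equals `-8L`. Of the `3(k+1)` copies of `e` retained, `2k+1` pay for the number of
  -- trees and `k+2` give the geometric decay.
  have hexponent : -(8 * √((n : ℝ) ^ 3 * complexity n d (δ * b) (k + 1))) ^ 2 / (8 * n ^ 3) ≤
      -Real.log (8 / (δ * b)) + ((3 * (k + 1) : ℕ) : ℝ) * -e := by
    rw [mul_pow, Real.sq_sqrt (by positivity)]
    have h1 : 0 ≤ Real.log (8 / (δ * b)) := by
      refine Real.log_nonneg ((one_le_div (by positivity)).2 ?_)
      nlinarith
    have h2 : 0 ≤ (k + 1 : ℝ) * e := by positivity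
    have h3 : complexity n d (δ * b) (k + 1) = Real.log (8 / (δ * b)) + (k + 1 : ℝ) * e := by
      rw [complexity]; push_cast; rfl
    rw [h3]
    push_cast
    have h4 : -(8 ^ 2 * ((n : ℝ) ^ 3 * (Real.log (8 / (δ * b)) + (k + 1 : ℝ) * e))) / (8 * n ^ 3)
        = -(8 * (Real.log (8 / (δ * b)) + (k + 1 : ℝ) * e)) := by
      field_simp
    rw [h4]
    linarith
  calc _ ≤ Real.exp e ^ (2 * k + 1) * (δ * Real.exp (-e) ^ (3 * (k + 1))) := by
        gcongr
        refine (Real.exp_le_exp.2 hexponent).trans ?_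
        rw [Real.exp_add, Real.exp_nat_mul]
        gcongr
    _ = δ * (Real.exp (-e)) ^ (k + 2) := by
        rw [show 3 * (k + 1) = (2 * k + 1) + (k + 2) by ring, pow_add (Real.exp (-e)),
          mul_left_comm, ← mul_assoc (Real.exp e ^ _), ← mul_pow, ← Real.exp_add]
        simp
    _ ≤ δ * (1 / 2) ^ (k + 2) := by
        gcongr
        rw [Real.exp_neg, ← one_div]
        gcongr
    _ ≤ δ * (1 / 2) ^ (k + 1) := by
        gcongr ?_ * ?_
        exact pow_le_pow_of_le_one (by norm_num) (by norm_num) (by omega)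

lemma sum_half_pow_succ_le (n : ℕ) : ∑ k ∈ Finset.range n, (1 / 2 : ℝ) ^ (k + 1) ≤ 1 := by
  have h : ∑ k ∈ Finset.range n, (1 / 2 : ℝ) ^ (k + 1) = 1 - (1 / 2) ^ n := by
    induction n with
    | zero => simp
    | succ n ih => rw [Finset.sum_range_succ, ih]; ring
  rw [h]
  linarith [pow_nonneg (by norm_num : (0 : ℝ) ≤ 1 / 2) n]

lemma exists_eq_prod_of_mem_indepModels {P : Measure (Pt p q)} (hP : P ∈ indepModels p q) :
    ∃ (μ : Measure (Fin p → ℝ)) (ν : Measure (Fin q → ℝ)),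
      IsProbabilityMeasure μ ∧ IsProbabilityMeasure ν ∧ P = μ.prod ν := by
  have := hP.1
  have h1 : IsProbabilityMeasure (P.map Prod.fst) :=
    Measure.isProbabilityMeasure_map measurable_fst.aemeasurable
  have h2 : IsProbabilityMeasure (P.map Prod.snd) :=
    Measure.isProbabilityMeasure_map measurable_snd.aemeasurable
  refine ⟨_, _, h1, h2, (Measure.prod_eq fun A B hA hB => ?_).symm⟩
  rw [hP.2 A B hA hB, mul_comm, Measure.map_apply measurable_fst hA,
    Measure.map_apply measurable_snd hB, ← Set.prod_univ, ← Set.univ_prod]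

lemma measure_iUnion_empGap_le [NeZero n] (hd : 1 ≤ p + q) {δ : ℝ} (hδ0 : 0 < δ) (hδ1 : δ ≤ 1)
    (hb0 : 0 < b) (hb1 : b ≤ 1) {P : Measure (Pt p q)} (hP : P ∈ indepModels p q) :
    (Measure.pi fun _ : Fin n => P) (⋃ k ∈ Finset.range n,
      ⋃ t : {t : DecisionTree (Coord p q × Fin n) // t.numSplits = k},
        {z | 8 * √((n : ℝ) ^ 3 * complexity n (p + q) (δ * b) (k + 1)) + 8 * n * k ≤
          empGap (t.1.signFun z) z}) ≤ ENNReal.ofReal δ := by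
  obtain ⟨μ, ν, hμ, hν, rfl⟩ := exists_eq_prod_of_mem_indepModels hP
  have htree : ∀ k, ∀ t : {t : DecisionTree (Coord p q × Fin n) // t.numSplits = k},
      (Measure.pi fun _ : Fin n => μ.prod ν)
        {z | 8 * √((n : ℝ) ^ 3 * complexity n (p + q) (δ * b) (k + 1)) + 8 * n * k ≤
          empGap (t.1.signFun z) z} ≤
      ENNReal.ofReal (Real.exp
        (-(8 * √((n : ℝ) ^ 3 * complexity n (p + q) (δ * b) (k + 1))) ^ 2 / (8 * n ^ 3))) := by
    intro k t
    refine le_trans (measure_mono fun z hz => ?_) (measure_empGap_ge_le_of_dependsOn μ ν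
      t.1.measurable_signFun (fun z x => t.1.abs_signFun_le z x) t.1.sampleIndices
      (fun z z' h => t.1.signFun_congr z z' h) (by positivity))
    have hcard : (t.1.sampleIndices.card : ℝ) ≤ k := by
      exact_mod_cast t.1.card_sampleIndices_le.trans_eq t.2
    rw [Set.mem_ofPred_eq] at hz ⊢
    refine le_trans ?_ hz
    gcongr
  have hlevel : ∀ k, (Measure.pi fun _ : Fin n => μ.prod ν)
      (⋃ t : {t : DecisionTree (Coord p q × Fin n) // t.numSplits = k},
        {z | 8 * √((n : ℝ) ^ 3 * complexity n (p + q) (δ * b) (k + 1)) + 8 * n * k ≤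
          empGap (t.1.signFun z) z}) ≤ ENNReal.ofReal (δ * (1 / 2) ^ (k + 1)) := by
    intro k
    have := Fintype.ofFinite {t : DecisionTree (Coord p q × Fin n) // t.numSplits = k}
    refine (measure_iUnion_fintype_le _ _).trans ((Finset.sum_le_sum fun t _ => htree k t).trans ?_)
    rw [Finset.sum_const, nsmul_eq_mul, ← ENNReal.ofReal_natCast,
      ← ENNReal.ofReal_mul (by positivity)]
    refine ENNReal.ofReal_le_ofReal (le_trans ?_
      (card_mul_exp_le (NeZero.one_le (n := n)) hd hδ0 hδ1 hb0 hb1 k))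
    have hcard := DecisionTree.card_numSplits_eq_le (α := Coord p q × Fin n) k
    rw [Nat.card_eq_fintype_card, Fintype.card_prod, Fintype.card_sum, Fintype.card_fin,
      Fintype.card_fin, Fintype.card_fin] at hcard
    gcongr
    rw [Finset.card_univ]
    exact_mod_cast hcard
  calc _ ≤ ∑ k ∈ Finset.range n, ENNReal.ofReal (δ * (1 / 2) ^ (k + 1)) :=
        (measure_biUnion_finset_le _ _).trans (Finset.sum_le_sum fun k _ => hlevel k)
    _ = ENNReal.ofReal (δ * ∑ k ∈ Finset.range n, (1 / 2) ^ (k + 1)) := by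
        rw [Finset.mul_sum, ENNReal.ofReal_sum_of_nonneg fun k _ => by positivity]
    _ ≤ ENNReal.ofReal δ :=
        ENNReal.ofReal_le_ofReal (mul_le_of_le_one_right hδ0.le (sum_half_pow_succ_le n))

/-- The level of the test, for a fixed sample size. -/
lemma rejectionProb_test_le [NeZero n] (hb0 : 0 < b) (hb1 : b ≤ 1) {δ : ℝ} (hδ0 : 0 < δ)
    {That : (Fin n → Pt p q) → BinaryTree Unit}
    (hThat : ∀ z, IsArgmax c b δ z (That z)) {P : Measure (Pt p q)} (hP : P ∈ indepModels p q)
    {a : ℝ} (ha : 0 < a) : rejectionProb P (test c That a) ≤ δ := by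
  have := hP.1
  rcases le_total 1 δ with hδ1 | hδ1
  · exact measureReal_le_one.trans hδ1
  -- The mere existence of a coordinate rule provides a coordinate.
  have hd : 1 ≤ p + q := by
    rcases c (fun _ => 0) [] with i | i <;> have := i.pos <;> omega
  refine ENNReal.toReal_le_of_le_ofReal hδ0.le (le_trans (measure_mono fun z hz => ?_)
    (measure_iUnion_empGap_le hd hδ0 hδ1 hb0 hb1 hP))
  have hrej : a ≤ logLikelihood (treePartition c z (That z)) z := by
    by_contra hlt
    exact hlt (by simpa [test] using hz)
  simpa only [Set.mem_iUnion, Set.mem_ofPred_eq, exists_prop] using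
    exists_decisionTree_of_isArgmax hd hb0 hb1 hδ0 hδ1 (hThat z) ha hrej

end TSP

end

theorem proposition2 (p q : ℕ) (l : ℝ) (hl : l ∈ Set.Ioo (0 : ℝ) (1 / 3))
    (b δ : ℕ → ℝ)
    (hb : ∀ n, 1 ≤ n → b n ∈ Set.Ioo (0 : ℝ) 1)
    (hδ : ∀ n, 1 ≤ n → 0 < δ n)
    (hb_rate : b =Θ[atTop] fun n : ℕ => (n : ℝ) ^ (-l))
    (hδ_zero : δ =o[atTop] fun _ : ℕ => (1 : ℝ))
    (hδ_rate : (fun n : ℕ => 1 / δ n) =O[atTop]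
      fun n : ℕ => Real.exp ((n : ℝ) ^ ((1 : ℝ) / 3)))
    (c : (n : ℕ) → TSP.CoordRule p q n)
    (That : (n : ℕ) → (Fin n → TSP.Pt p q) → BinaryTree Unit)
    (hThat : ∀ n, 1 ≤ n → ∀ z : Fin n → TSP.Pt p q,
      TSP.IsArgmax (c n) (b n) (δ n) z (That n z)) :
    ∀ P ∈ TSP.indepModels p q, ∀ a : ℕ → ℝ, (∀ n, 1 ≤ n → 0 < a n) →
      ∀ n, 1 ≤ n → TSP.rejectionProb P (TSP.test (c n) (That n) (a n)) ≤ δ n := by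
  intro P hP a ha n hn
  have : NeZero n := ⟨by omega⟩
  exact TSP.rejectionProb_test_le (hb n hn).1 (hb n hn).2.le (hδ n hn) (hThat n hn) hP (ha n hn)
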